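/- **Definitions.** A *homotopical structure* on a category $\mathbf C$ is a rule associating with each object $S$ an object $\hat S$ and two morphisms $i_S, j_S : S \to \hat S$ such that: I. for every $S$ there is $p:\hat S\to S$ with $p\,i_S = p\,j_S = 1_S$; II. for every $S$ there is $k:\hat S\to\hat S$ with $k\,i_S = j_S$ and $k\,j_S = i_S$; III. for all $S,T$ and all $h,h^*:\hat S\to T$ with $h^* i_S = h\,j_S$ there is $h^{**}:\hat S\to T$ with $h^{**} i_S = h\,i_S$ and $h^{**} j_S = h^* j_S$; IV. for all $S,T$ and every $u:S\to T$ there is $\hat u:\hat S\to\hat T$ with $\hat u\,i_S = i_T u$ and $\hat u\,j_S = j_T u$. Let $\mathbf Q$ be the category whose objects are the compact convex subsets of (real) Hausdorff locally convex spaces and whose morphisms $S\to T$ are the continuous affine maps $f:S\to T$ with $f(\operatorname{ex} S)\subseteq \operatorname{ex} T$, where $\operatorname{ex}$ denotes the set of extreme points. Let $P=\{\mu\in C([0,1])^* : \mu\ge 0,\ \|\mu\|=1\}$ with the weak-$*$ topology, and let $\delta_t\in P$ be evaluation at $t$. For compact convex sets $S,T$, the projective tensor product $S\hat\otimes_\pi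 T$ is the set of positive functionals $\varphi$ with $\varphi(1)=1$ on the normed space of continuous biaffine functions $S\times T\to\mathbb R$ (supremum norm), with the weak-$*$ topology, and $\omega_{\pi}:S\times T\to S\hat\otimes_\pi T$ sends $(s,t)$ to the evaluation at $(s,t)$. **Theorem 2.** For every object $S$ of $\mathbf Q$, the maps $i_S(s)=\omega_\pi(s,\delta_0)$ and $j_S(s)=\omega_\pi(s,\delta_1)$ are morphisms $S\to S\hat\otimes_\pi P$ of $\mathbf Q$, and the correspondence $S\mapsto (S\hat\otimes_\pi P;\, i_S, j_S)$ is a homotopical structure on $\mathbf Q$. -/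

import Mathlib

open CategoryTheory

universe u v w

/-! ## Homotopical structures on a category -/

/-- A correspondence `S ↦ (hat S; i S, j S)`, with `i S, j S : S ⟶ hat S`, is a homotopical
structure on the category `C`. -/
structure IsHomotopicalStructure {C : Type u} [Category.{v} C] (hat : C → C)
    (i j : ∀ S : C, S ⟶ hat S) : Prop where
  /-- Axiom I: the two morphisms have a common retraction. -/
  retraction : ∀ S : C, ∃ p : hat S ⟶ S, i S ≫ p = 𝟙 S ∧ j S ≫ p = 𝟙 S
  /-- Axiom II: an endomorphism exchanges the two morphisms. -/
  reversal : ∀ S : C, ∃ k : hat S ⟶ hat S, i S ≫ k = j S ∧ j S ≫ k = i S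
  /-- Axiom III: concatenation. -/
  concatenation : ∀ (S T : C) (h h' : hat S ⟶ T), i S ≫ h' = j S ≫ h →
    ∃ h'' : hat S ⟶ T, i S ≫ h = i S ≫ h'' ∧ j S ≫ h' = j S ≫ h''
  /-- Axiom IV: every morphism lifts. -/
  lift : ∀ (S T : C) (f : S ⟶ T),
    ∃ g : hat S ⟶ hat T, i S ≫ g = f ≫ i T ∧ j S ≫ g = f ≫ j T

/-! ## The category of compact convex sets -/

/-- A compact convex subset of a (real) Hausdorff locally convex space. -/
structure CompactConvex : Type (u + 1) where
  /-- The ambient locally convex space. -/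
  Space : Type u
  [addCommGroup : AddCommGroup Space]
  [module : Module ℝ Space]
  [topologicalSpace : TopologicalSpace Space]
  [isTopologicalAddGroup : IsTopologicalAddGroup Space]
  [continuousSMul : ContinuousSMul ℝ Space]
  [t2Space : T2Space Space]
  [locallyConvexSpace : LocallyConvexSpace ℝ Space]
  /-- The underlying set. -/
  carrier : Set Space
  convex : Convex ℝ carrier
  isCompact : IsCompact carrier

/-- The weak-star topology is locally convex. -/
instance locallyConvexSpace_weakDual {V : Type u} [AddCommGroup V] [Module ℝ V]
    [TopologicalSpace V] : LocallyConvexSpace ℝ (WeakDual ℝ V) :=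
  WeakBilin.locallyConvexSpace (B := topDualPairing ℝ V)

namespace CompactConvex

attribute [instance] addCommGroup module topologicalSpace isTopologicalAddGroup continuousSMul
  t2Space locallyConvexSpace

/-- The points of a compact convex set, with the subspace topology. -/
abbrev Pt (S : CompactConvex.{u}) : Type u := S.carrier

instance (S : CompactConvex.{u}) : CompactSpace S.Pt := isCompact_iff_compactSpace.mp S.isCompact

/-- A map from a compact convex set to a real vector space is affine if it preserves convex
combinations. -/
def IsAffine (S : CompactConvex.{u}) {V : Type w} [AddCommGroup V] [Module ℝ V]
    (f : S.Pt → V) : Prop :=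
  ∀ (x y z : S.Pt) (a b : ℝ), 0 ≤ a → 0 ≤ b → a + b = 1 →
    (z : S.Space) = a • (x : S.Space) + b • (y : S.Space) → f z = a • f x + b • f y

/-- `x` is an extreme point of `S`. -/
def IsExtremePt (S : CompactConvex.{u}) (x : S.Pt) : Prop :=
  (x : S.Space) ∈ S.carrier.extremePoints ℝ

/-- Morphisms: continuous affine maps sending extreme points to extreme points. -/
@[ext]
structure Hom (S T : CompactConvex.{u}) : Type u where
  toFun : S.Pt → T.Pt
  continuous_toFun : Continuous toFun
  isAffine_toFun : S.IsAffine fun x => (toFun x : T.Space)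
  isExtremePt_toFun : ∀ x, S.IsExtremePt x → T.IsExtremePt (toFun x)

instance : Category.{u} CompactConvex.{u} where
  Hom := Hom
  id S := ⟨id, continuous_id, fun _ _ _ _ _ _ _ _ h => h, fun _ h => h⟩
  comp f g := ⟨g.toFun ∘ f.toFun, g.continuous_toFun.comp f.continuous_toFun,
    fun x y z a b ha hb hab h => g.isAffine_toFun _ _ _ a b ha hb hab
      (f.isAffine_toFun x y z a b ha hb hab h),
    fun x hx => g.isExtremePt_toFun _ (f.isExtremePt_toFun x hx)⟩

/-! ## The projective tensor product -/

/-- The space of continuous biaffine real functions on `S × T`, with the supremum norm. -/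
def Biaffine (S : CompactConvex.{u}) (T : CompactConvex.{v}) : Submodule ℝ C(S.Pt × T.Pt, ℝ) where
  carrier := {f | (∀ t, S.IsAffine fun s => f (s, t)) ∧ ∀ s, T.IsAffine fun t => f (s, t)}
  zero_mem' := by constructor <;> intro _ <;> simp [IsAffine]
  add_mem' := by
    rintro f g ⟨hf, hf'⟩ ⟨hg, hg'⟩
    refine ⟨fun t x y z a b ha hb hab h => ?_, fun s x y z a b ha hb hab h => ?_⟩
    · have h1 := hf t x y z a b ha hb hab h
      have h2 := hg t x y z a b ha hb hab h
      simp only [smul_eq_mul, ContinuousMap.add_apply] at *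
      rw [h1, h2]; ring
    · have h1 := hf' s x y z a b ha hb hab h
      have h2 := hg' s x y z a b ha hb hab h
      simp only [smul_eq_mul, ContinuousMap.add_apply] at *
      rw [h1, h2]; ring
  smul_mem' := by
    rintro c f ⟨hf, hf'⟩
    refine ⟨fun t x y z a b ha hb hab h => ?_, fun s x y z a b ha hb hab h => ?_⟩
    · have h1 := hf t x y z a b ha hb hab h
      simp only [smul_eq_mul, ContinuousMap.smul_apply] at *
      rw [h1]; ring
    · have h1 := hf' s x y z a b ha hb hab h
      simp only [smul_eq_mul, ContinuousMap.smul_apply] at *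
      rw [h1]; ring

/-- The constant function `1`. -/
def Biaffine.one (S : CompactConvex.{u}) (T : CompactConvex.{v}) : Biaffine S T :=
  ⟨1, fun _ _ _ _ _ _ _ _ hab _ => by simp [hab], fun _ _ _ _ _ _ _ _ hab _ => by simp [hab]⟩

/-- The state space of the space of continuous biaffine functions: the positive functionals that
take the value `1` at the constant function `1`. -/
def states (S : CompactConvex.{u}) (T : CompactConvex.{v}) : Set (WeakDual ℝ (Biaffine S T)) :=
  {φ | (∀ f : Biaffine S T, (∀ x, 0 ≤ f.1 x) → 0 ≤ φ f) ∧ φ (Biaffine.one S T) = 1}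

theorem convex_states (S : CompactConvex.{u}) (T : CompactConvex.{v}) :
    Convex ℝ (states S T) := by
  rintro φ ⟨hφ, hφ1⟩ ψ ⟨hψ, hψ1⟩ a b ha hb hab
  refine ⟨fun f hf => ?_, ?_⟩
  · exact add_nonneg (mul_nonneg ha (hφ f hf)) (mul_nonneg hb (hψ f hf))
  · change a * φ _ + b * ψ _ = 1
    rw [hφ1, hψ1, mul_one, mul_one, hab]

theorem isCompact_states (S : CompactConvex.{u}) (T : CompactConvex.{v}) :
    IsCompact (states S T) := by
  refine (WeakDual.isCompact_closedBall (𝕜 := ℝ) (E := Biaffine S T) 0 1).of_isClosed_subset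
    ?_ ?_
  · have h : states S T = (⋂ (f : Biaffine S T) (_ : ∀ x, 0 ≤ f.1 x), {φ | 0 ≤ φ f}) ∩
        {φ | φ (Biaffine.one S T) = 1} := by
      ext φ; simp [states]
    rw [h]
    refine IsClosed.inter (isClosed_iInter fun f => isClosed_iInter fun _ => ?_) ?_
    · exact isClosed_le continuous_const (WeakDual.eval_continuous f)
    · exact isClosed_eq (WeakDual.eval_continuous _) continuous_const
  · rintro φ ⟨hφ, hφ1⟩
    simp only [Set.mem_preimage, mem_closedBall_zero_iff]
    refine ContinuousLinearMap.opNorm_le_bound _ zero_le_one fun f => ?_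
    change |φ f| ≤ 1 * ‖f‖
    have hb : ∀ x, |f.1 x| ≤ ‖f‖ := fun x => f.1.norm_coe_le_norm x
    have h1 : 0 ≤ φ (‖f‖ • Biaffine.one S T - f) := hφ _ fun x => by
      have := (abs_le.mp (hb x)).2
      change 0 ≤ ‖f‖ * 1 - f.1 x
      linarith
    have h2 : 0 ≤ φ (‖f‖ • Biaffine.one S T + f) := hφ _ fun x => by
      have := (abs_le.mp (hb x)).1
      change 0 ≤ ‖f‖ * 1 + f.1 x
      linarith
    rw [map_sub, map_smul, hφ1, smul_eq_mul] at h1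
    rw [map_add, map_smul, hφ1, smul_eq_mul] at h2
    rw [abs_le]
    constructor <;> linarith

/-- The projective tensor product of two compact convex sets: the state space of the space of
continuous biaffine functions on `S × T`, with the weak-star topology. -/
noncomputable def projTensor (S : CompactConvex.{u}) (T : CompactConvex.{v}) : CompactConvex.{max u v} where
  Space := WeakDual ℝ (Biaffine S T)
  carrier := states S T
  convex := convex_states S T
  isCompact := isCompact_states S T

/-- The canonical map `S × T → S ⊗ T`: a pair of points is sent to the evaluation there. -/
noncomputable def omega (S : CompactConvex.{u}) (T : CompactConvex.{v}) (s : S.Pt) (t : T.Pt) :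
    (projTensor S T).Pt :=
  ⟨StrongDual.toWeakDual
    ((ContinuousMap.evalCLM ℝ (s, t)).comp (Biaffine S T).subtypeL),
    fun _ hf => hf (s, t), rfl⟩

end CompactConvex

/-! ## Probability measures on the unit interval -/

open CompactConvex

/-- The positive functionals of norm `1` on `C([0,1])`. -/
def probSet : Set (WeakDual ℝ C(unitInterval, ℝ)) :=
  {μ | (∀ f : C(unitInterval, ℝ), 0 ≤ f → 0 ≤ μ f) ∧ ‖WeakDual.toStrongDual μ‖ = 1}

theorem norm_eq_of_nonneg (μ : WeakDual ℝ C(unitInterval, ℝ))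
    (hμ : ∀ f : C(unitInterval, ℝ), 0 ≤ f → 0 ≤ μ f) : ‖WeakDual.toStrongDual μ‖ = μ 1 := by
  apply le_antisymm
  · refine ContinuousLinearMap.opNorm_le_bound _ (hμ 1 zero_le_one) fun f => ?_
    change |μ f| ≤ μ 1 * ‖f‖
    have hb : ∀ x, |f x| ≤ ‖f‖ := fun x => f.norm_coe_le_norm x
    have h1 : 0 ≤ μ (‖f‖ • 1 - f) := hμ _ fun x => by
      have := (abs_le.mp (hb x)).2
      change 0 ≤ ‖f‖ * 1 - f x
      linarith
    have h2 : 0 ≤ μ (‖f‖ • 1 + f) := hμ _ fun x => by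
      have := (abs_le.mp (hb x)).1
      change 0 ≤ ‖f‖ * 1 + f x
      linarith
    rw [map_sub, map_smul, smul_eq_mul] at h1
    rw [map_add, map_smul, smul_eq_mul] at h2
    rw [abs_le]
    constructor <;> linarith
  · have h := (WeakDual.toStrongDual μ).le_opNorm 1
    rw [norm_one, mul_one] at h
    exact (le_abs_self _).trans h

theorem mem_probSet_iff (μ : WeakDual ℝ C(unitInterval, ℝ)) : μ ∈ probSet ↔
    (∀ f : C(unitInterval, ℝ), 0 ≤ f → 0 ≤ μ f) ∧ μ 1 = 1 :=
  and_congr_right fun h => by rw [norm_eq_of_nonneg μ h]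

theorem convex_probSet : Convex ℝ probSet := by
  intro φ hφ ψ hψ a b ha hb hab
  rw [mem_probSet_iff] at *
  refine ⟨fun f hf => ?_, ?_⟩
  · exact add_nonneg (mul_nonneg ha (hφ.1 f hf)) (mul_nonneg hb (hψ.1 f hf))
  · change a * φ _ + b * ψ _ = 1
    rw [hφ.2, hψ.2, mul_one, mul_one, hab]

theorem isCompact_probSet : IsCompact probSet := by
  refine (WeakDual.isCompact_closedBall (𝕜 := ℝ)
    (0 : StrongDual ℝ C(unitInterval, ℝ)) 1).of_isClosed_subset ?_ ?_
  · have h : probSet = (⋂ (f : C(unitInterval, ℝ)) (_ : 0 ≤ f), {μ | 0 ≤ μ f}) ∩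
        {μ | μ 1 = 1} := by
      ext μ; simp [mem_probSet_iff]
    rw [h]
    refine IsClosed.inter (isClosed_iInter fun f => isClosed_iInter fun _ => ?_) ?_
    · exact isClosed_le continuous_const (WeakDual.eval_continuous f)
    · exact isClosed_eq (WeakDual.eval_continuous _) continuous_const
  · rintro μ ⟨_, hμ⟩
    simp only [Set.mem_preimage, mem_closedBall_zero_iff]
    exact hμ.le

/-- The compact convex set `P` of probability measures on `[0,1]`, with the weak-star topology. -/
noncomputable def probMeasures : CompactConvex.{0} where
  Space := WeakDual ℝ C(unitInterval, ℝ)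
  carrier := probSet
  convex := convex_probSet
  isCompact := isCompact_probSet

/-- The Dirac measure at `t`. -/
noncomputable def dirac (t : unitInterval) : probMeasures.Pt :=
  ⟨StrongDual.toWeakDual (ContinuousMap.evalCLM ℝ t),
    (mem_probSet_iff _).mpr ⟨fun _ hf => hf t, rfl⟩⟩

/-! The point of `S ⊗ P` is that it represents homotopies: a morphism out of it amounts to a
continuous family, indexed by `[0,1]`, of morphisms out of `S`. The four axioms then follow from the
constant homotopy, time reversal, concatenation, and composition with a morphism.

Extension (`exists_extension`): given `H : S × [0,1] → T`, affine in `s`, a continuous affine `f` on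
`T` pulls back to the biaffine function `(s, μ) ↦ ∫ f (H (s, t)) dμ(t)`. A state `φ` of the biaffine
functions thus yields a state of the affine functions on `T`, which is evaluation at a point of `T`
(`exists_eval`); that point is the image of `φ`.

Extreme points: those of `S ⊗ P` are exactly the `s ⊗ δ_t` with `s` extreme, so the extension is a
morphism as soon as each `H (·, t)` is one. That these points are extreme is a domination argument
(`functional_eq_zero`). That there are no others follows from Milman's theorem, since the compact
set of all `s ⊗ δ_t` has closed convex hull `S ⊗ P`. -/

open Set Topology in
/-- **Milman's partial converse to the Krein–Milman theorem**. -/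
theorem mem_of_mem_extremePoints_of_subset_closedConvexHull {E : Type*} [AddCommGroup E]
    [Module ℝ E] [TopologicalSpace E] [IsTopologicalAddGroup E] [ContinuousSMul ℝ E] [T2Space E]
    [LocallyConvexSpace ℝ E] {X K : Set E} (hX : IsCompact X) (hXc : Convex ℝ X)
    (hK : IsCompact K) (hKX : K ⊆ X) (hXK : X ⊆ closedConvexHull ℝ K) {x : E}
    (hx : x ∈ X.extremePoints ℝ) : x ∈ K := by
  by_contra hxK
  -- Compactness induction: lying in a compact convex subset of `X` that misses `x` is a local
  -- property, stable under unions.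
  obtain ⟨D, hD, hDc, -, hxD, hKD⟩ :
      ∃ D : Set E, IsCompact D ∧ Convex ℝ D ∧ D ⊆ X ∧ x ∉ D ∧ K ⊆ D := by
    refine hK.induction_on (p := fun s => ∃ D : Set E, IsCompact D ∧ Convex ℝ D ∧ D ⊆ X ∧
      x ∉ D ∧ s ⊆ D) ?_ ?_ ?_ ?_
    · exact ⟨∅, isCompact_empty, convex_empty, empty_subset _, notMem_empty _, subset_rfl⟩
    · rintro s t hst ⟨D, h1, h2, h3, h4, h5⟩
      exact ⟨D, h1, h2, h3, h4, hst.trans h5⟩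
    · rintro s t ⟨A, hA, hAc, hAX, hxA, hsA⟩ ⟨B, hB, hBc, hBX, hxB, htB⟩
      rcases A.eq_empty_or_nonempty with rfl | hAn
      · exact ⟨B, hB, hBc, hBX, hxB, union_subset (hsA.trans (empty_subset _)) htB⟩
      rcases B.eq_empty_or_nonempty with rfl | hBn
      · exact ⟨A, hA, hAc, hAX, hxA, union_subset hsA (htB.trans (empty_subset _))⟩
      -- The join of two compact convex sets is compact and convex; extremality of `x` keeps it off
      -- every segment from `A` to `B`.
      refine ⟨convexJoin ℝ A B, ?_, hAc.convexJoin hBc, ?_, ?_, ?_⟩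
      · have : convexJoin ℝ A B =
            (fun p : ℝ × E × E => AffineMap.lineMap p.2.1 p.2.2 p.1) '' (Icc 0 1 ×ˢ A ×ˢ B) := by
          ext z
          simp only [mem_convexJoin, segment_eq_image_lineMap, mem_image, mem_prod, Prod.exists]
          constructor
          · rintro ⟨a, ha, b, hb, t, ht, rfl⟩
            exact ⟨t, a, b, ⟨ht, ha, hb⟩, rfl⟩
          · rintro ⟨t, a, b, ⟨ht, ha, hb⟩, rfl⟩
            exact ⟨a, ha, b, hb, t, ht, rfl⟩
        rw [this]
        refine (isCompact_Icc.prod (hA.prod hB)).image ?_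
        simp only [AffineMap.lineMap_apply_module]
        fun_prop
      · exact convexJoin_subset_convexHull _ _ |>.trans
          (convexHull_min (union_subset hAX hBX) hXc)
      · intro h
        obtain ⟨a, ha, b, hb, hab⟩ := mem_convexJoin.mp h
        rcases (mem_extremePoints_iff_forall_segment.mp hx).2 a (hAX ha) b (hBX hb) hab with
          rfl | rfl
        · exact hxA ha
        · exact hxB hb
      · exact union_subset (hsA.trans (subset_convexJoin_left hBn))
          (htB.trans (subset_convexJoin_right hAn))
    · intro y hy
      -- Near `y`, cut `X` by a closed half-space that excludes `x`.
      obtain ⟨f, hf⟩ := geometric_hahn_banach_point_point (E := E) (x := y) (y := x)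
        (fun h => hxK (h ▸ hy))
      obtain ⟨c, hc1, hc2⟩ := exists_between hf
      refine ⟨K ∩ {z | f z < c}, Filter.inter_mem self_mem_nhdsWithin (mem_nhdsWithin_of_mem_nhds
        ((isOpen_lt f.continuous continuous_const).mem_nhds hc1)), X ∩ {z | f z ≤ c},
        hX.inter_right (isClosed_le f.continuous continuous_const),
        hXc.inter (convex_halfSpace_le f.toLinearMap.isLinear c), inter_subset_left,
        fun h => hc2.not_ge h.2, fun z hz => ⟨hKX hz.1, (show f z < c from hz.2).le⟩⟩
  exact hxD (closedConvexHull_min hKD hDc hD.isClosed (hXK hx.1))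

/-! ### Continuous affine functions and their states -/

namespace CompactConvex

/-- The space of continuous affine real functions on a compact convex set. -/
def affineFunctions (S : CompactConvex.{u}) : Submodule ℝ C(S.Pt, ℝ) where
  carrier := {f | S.IsAffine f}
  zero_mem' := by intro; simp
  add_mem' := by
    intro f g hf hg x y z a b ha hb hab h
    have h1 := hf x y z a b ha hb hab h
    have h2 := hg x y z a b ha hb hab h
    simp only [smul_eq_mul, ContinuousMap.add_apply] at *
    rw [h1, h2]; ring
  smul_mem' := by
    intro c f hf x y z a b ha hb hab h
    have h1 := hf x y z a b ha hb hab h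
    simp only [smul_eq_mul, ContinuousMap.smul_apply] at *
    rw [h1]; ring

namespace affineFunctions

/-- The constant function `1`. -/
def one (S : CompactConvex.{u}) : S.affineFunctions :=
  ⟨1, fun _ _ _ _ _ _ _ hab _ => by simp [hab]⟩

/-- The restriction of a continuous linear functional. -/
def ofDual (S : CompactConvex.{u}) (l : S.Space →L[ℝ] ℝ) : S.affineFunctions :=
  ⟨⟨fun x => l x, by fun_prop⟩, fun x y z a b _ _ _ h => by
    change l z = a • l x + b • l y
    rw [h]; simp⟩

end affineFunctions

theorem eq_of_forall_affineFunctions {S : CompactConvex.{u}} {x y : S.Pt}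
    (h : ∀ f : S.affineFunctions, f.1 x = f.1 y) : x = y := by
  by_contra hxy
  obtain ⟨l, hl⟩ := geometric_hahn_banach_point_point (E := S.Space) (x := x) (y := y)
    (fun h => hxy (Subtype.ext h))
  exact hl.ne (h (affineFunctions.ofDual S l))

/-- A convex combination in a compact convex set. -/
def combo (S : CompactConvex.{u}) (x y : S.Pt) {a b : ℝ} (ha : 0 ≤ a) (hb : 0 ≤ b)
    (hab : a + b = 1) : S.Pt :=
  ⟨a • (x : S.Space) + b • (y : S.Space), S.convex x.2 y.2 ha hb hab⟩

/-- Finitely many affine functions map `S` onto a compact convex set in a finite-dimensional space.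
If the vector of values of `L` were outside it, a separating hyperplane would give a positive affine
function on which `L` is negative. -/
theorem exists_eval_finite {S : CompactConvex.{u}} (L : S.affineFunctions →ₗ[ℝ] ℝ)
    (hpos : ∀ f : S.affineFunctions, (∀ x, 0 ≤ f.1 x) → 0 ≤ L f)
    (hone : L (affineFunctions.one S) = 1) (u : Finset S.affineFunctions) :
    ∃ y : S.Pt, ∀ f ∈ u, f.1 y = L f := by
  classical
  let Φ : S.Pt → (u → ℝ) := fun y f => f.1.1 y
  have hΦ : Continuous Φ := continuous_pi fun f => f.1.1.continuous
  have hconv : Convex ℝ (Set.range Φ) := by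
    rintro _ ⟨x, rfl⟩ _ ⟨y, rfl⟩ a b ha hb hab
    exact ⟨S.combo x y ha hb hab, funext fun f => f.1.2 x y _ a b ha hb hab rfl⟩
  by_cases hmem : (fun f : u => L f.1) ∈ Set.range Φ
  · obtain ⟨y, hy⟩ := hmem
    exact ⟨y, fun f hf => congrFun hy ⟨f, hf⟩⟩
  · exfalso
    obtain ⟨l, c, hlc, hc⟩ := geometric_hahn_banach_point_closed hconv
      (isCompact_range hΦ).isClosed hmem
    have hl : ∀ v : u → ℝ, l v = ∑ f, v f * l (Pi.single f 1) := fun v => by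
      conv_lhs => rw [pi_eq_sum_univ' v]
      rw [map_sum]
      refine Finset.sum_congr rfl fun f _ => ?_
      rw [map_smul, smul_eq_mul]
    have h := hpos (∑ f : u, l (Pi.single f 1) • f.1 - c • affineFunctions.one S) fun x => by
      have := hc _ ⟨x, rfl⟩
      rw [hl] at this
      have e : (∑ f : u, l (Pi.single f 1) • f.1 - c • affineFunctions.one S).1 x
          = ∑ f : u, Φ x f * l (Pi.single f 1) - c * 1 := by
        simp [affineFunctions.one, Φ, mul_comm]
      rw [e]
      linarith
    rw [map_sub, map_smul, hone, map_sum] at h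
    rw [hl] at hlc
    simp only [map_smul, smul_eq_mul] at h
    simp only [mul_comm] at h hlc
    linarith

/-- Every state of the space of continuous affine functions is an evaluation. -/
theorem exists_eval {S : CompactConvex.{u}} (L : S.affineFunctions →ₗ[ℝ] ℝ)
    (hpos : ∀ f : S.affineFunctions, (∀ x, 0 ≤ f.1 x) → 0 ≤ L f)
    (hone : L (affineFunctions.one S) = 1) : ∃ y : S.Pt, ∀ f, f.1 y = L f := by
  -- Finite intersection property for the closed conditions `f y = L f`.
  have h := CompactSpace.iInter_nonempty (X := S.Pt) (t := fun f : S.affineFunctions => {y : S.Pt | f.1 y = L f})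
    (fun f : S.affineFunctions => isClosed_eq f.1.continuous continuous_const) (fun u => by
      obtain ⟨y, hy⟩ := exists_eval_finite L hpos hone u
      exact ⟨y, by simpa using hy⟩)
  obtain ⟨y, hy⟩ := h
  exact ⟨y, by simpa using hy⟩

/-! ### Biaffine functions on `S × P` -/

theorem continuous_dirac : Continuous dirac :=
  Continuous.subtype_mk (WeakDual.continuous_of_continuous_eval fun f => f.continuous) _

/-- The integral against a probability measure. -/
noncomputable def integ (μ : probMeasures.Pt) : StrongDual ℝ C(unitInterval, ℝ) :=
  WeakDual.toStrongDual (show WeakDual ℝ C(unitInterval, ℝ) from μ.1)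

theorem continuous_integ_apply (f : C(unitInterval, ℝ)) : Continuous fun μ => integ μ f :=
  (WeakDual.eval_continuous f).comp continuous_subtype_val

theorem integ_nonneg (μ : probMeasures.Pt) {f : C(unitInterval, ℝ)} (h : ∀ t, 0 ≤ f t) :
    0 ≤ integ μ f := μ.2.1 f h

/-- Evaluation of measures at continuous functions is jointly continuous. -/
theorem continuous_pairing :
    Continuous fun p : C(unitInterval, ℝ) × probMeasures.Pt => integ p.2 p.1 := by
  rw [continuous_iff_continuousAt]
  rintro ⟨f₀, μ₀⟩
  -- Split `∫ f dμ = ∫ (f - f₀) dμ + ∫ f₀ dμ`; the first term is at most `‖f - f₀‖` since `‖μ‖ = 1`.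
  have h1 : Filter.Tendsto (fun p : C(unitInterval, ℝ) × probMeasures.Pt => integ p.2 (p.1 - f₀))
      (nhds (f₀, μ₀)) (nhds 0) := by
    refine squeeze_zero_norm (a := fun p => ‖p.1 - f₀‖) (fun p => ?_) ?_
    · have := (integ p.2).le_opNorm (p.1 - f₀)
      have h2 : ‖integ p.2‖ = 1 := p.2.2.2
      rw [h2, one_mul] at this
      exact this
    · have : Continuous fun p : C(unitInterval, ℝ) × probMeasures.Pt => ‖p.1 - f₀‖ := by fun_prop
      simpa using this.tendsto (f₀, μ₀)
  have h2 : Continuous fun p : C(unitInterval, ℝ) × probMeasures.Pt => integ p.2 f₀ :=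
    (continuous_integ_apply f₀).comp continuous_snd
  have h3 := h1.add (h2.tendsto (f₀, μ₀))
  simp only [zero_add, map_sub, sub_add_cancel] at h3
  exact h3

theorem apply_one (μ : probMeasures.Pt) : integ μ 1 = 1 := ((mem_probSet_iff _).mp μ.2).2

theorem isAffine_apply (g : C(unitInterval, ℝ)) : probMeasures.IsAffine fun μ => integ μ g :=
  fun _ _ _ _ _ _ _ _ h => congrArg (fun ν : WeakDual ℝ C(unitInterval, ℝ) => ν g) h

/-- A continuous affine function of a measure is the integral of its values at the Dirac
measures. -/
theorem affineFunctions.apply_eq (f : probMeasures.affineFunctions) (μ : probMeasures.Pt) :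
    f.1 μ = integ μ (f.1.comp ⟨dirac, continuous_dirac⟩) := by
  -- The right-hand side is a state in `f`, hence evaluation at some `ν`; testing on `f = ∫ g d(·)`
  -- forces `ν = μ`.
  obtain ⟨ν, hν⟩ := exists_eval (S := probMeasures)
    (L := { toFun := fun f => integ μ (f.1.comp ⟨dirac, continuous_dirac⟩)
            map_add' := fun f g => (integ μ).map_add (f.1.comp ⟨dirac, continuous_dirac⟩) (g.1.comp ⟨dirac, continuous_dirac⟩)
            map_smul' := fun c f => (integ μ).map_smul c (f.1.comp ⟨dirac, continuous_dirac⟩) })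
    (fun f hf => integ_nonneg μ fun t => hf _) (apply_one μ)
  have : ν = μ := Subtype.ext <| ContinuousLinearMap.ext fun g =>
    hν ⟨⟨fun μ => integ μ g, continuous_integ_apply g⟩, isAffine_apply g⟩
  rw [← this]
  conv_lhs => rw [hν]
  rw [this]; rfl

variable {S : CompactConvex.{u}}

namespace Biaffine

/-- The biaffine function `(s, μ) ↦ ∫ F(s, t) dμ(t)`. -/
noncomputable def integral (F : C(S.Pt × unitInterval, ℝ))
    (hF : ∀ t, S.IsAffine fun s => F (s, t)) : Biaffine S probMeasures :=
  ⟨⟨fun p => integ p.2 (F.curry p.1), continuous_pairing.comp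
      ((F.curry.continuous.comp continuous_fst).prodMk continuous_snd)⟩,
    fun μ x y z a b ha hb hab h => by
      change integ μ (F.curry z) = a • integ μ (F.curry x) + b • integ μ (F.curry y)
      rw [← (integ μ).map_smul, ← (integ μ).map_smul, ← (integ μ).map_add]
      exact congrArg _ (ContinuousMap.ext fun t => hF t x y z a b ha hb hab h),
    fun s => isAffine_apply (F.curry s)⟩

/-- The restriction of a biaffine function to a slice. -/
noncomputable def slice (F : Biaffine S probMeasures) (μ : probMeasures.Pt) : S.affineFunctions :=
  ⟨⟨fun s => F.1 (s, μ), by fun_prop⟩, F.2.1 μ⟩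

theorem apply_eq (F : Biaffine S probMeasures) (s : S.Pt) (μ : probMeasures.Pt) :
    F.1 (s, μ) = integ μ ⟨fun t => F.1 (s, dirac t), by have := continuous_dirac; fun_prop⟩ :=
  affineFunctions.apply_eq ⟨⟨fun μ => F.1 (s, μ), by fun_prop⟩, F.2.2 s⟩ μ

/-- A continuous affine function of the first variable. -/
noncomputable def ofFst (S : CompactConvex.{u}) : S.affineFunctions →ₗ[ℝ] Biaffine S probMeasures where
  toFun f := ⟨⟨fun p => f.1 p.1, by fun_prop⟩, fun _ => f.2,
    fun s _ _ _ a b _ _ hab _ => by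
      change f.1 s = a * f.1 s + b * f.1 s
      rw [← add_mul, hab, one_mul]⟩
  map_add' _ _ := rfl
  map_smul' _ _ := rfl

/-- The integral of a continuous function, as a function of the second variable. -/
noncomputable def ofSnd (S : CompactConvex.{u}) (g : C(unitInterval, ℝ)) : Biaffine S probMeasures :=
  ⟨⟨fun p => integ p.2 g, (continuous_integ_apply g).comp continuous_snd⟩,
    fun μ _ _ _ a b _ _ hab _ => by
      change integ μ g = a * integ μ g + b * integ μ g
      rw [← add_mul, hab, one_mul],
    fun _ => isAffine_apply g⟩

end Biaffine

/-! ### Points of the tensor product as functionals; extension of homotopies -/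

/-- A point of the tensor product, as a functional. -/
noncomputable def functional (φ : (S.projTensor probMeasures).Pt) :
    StrongDual ℝ (Biaffine S probMeasures) :=
  WeakDual.toStrongDual (show WeakDual ℝ (Biaffine S probMeasures) from φ.1)

theorem functional_injective : Function.Injective (functional (S := S)) := fun _ _ h =>
  Subtype.ext h

theorem functional_nonneg (φ : (S.projTensor probMeasures).Pt) {F : Biaffine S probMeasures}
    (hF : ∀ x, 0 ≤ F.1 x) : 0 ≤ functional φ F := φ.2.1 F hF

theorem functional_one (φ : (S.projTensor probMeasures).Pt) :
    functional φ (Biaffine.one S probMeasures) = 1 := φ.2.2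

theorem functional_omega (s : S.Pt) (μ : probMeasures.Pt) (F : Biaffine S probMeasures) :
    functional (S.omega probMeasures s μ) F = F.1 (s, μ) := rfl

theorem continuous_functional_apply (F : Biaffine S probMeasures) :
    Continuous fun φ => functional φ F :=
  (WeakDual.eval_continuous F).comp continuous_subtype_val

theorem functional_convex {φ ψ χ : (S.projTensor probMeasures).Pt} {a b : ℝ}
    (h : (χ : (S.projTensor probMeasures).Space) = a • φ.1 + b • ψ.1)
    (F : Biaffine S probMeasures) :
    functional χ F = a * functional φ F + b * functional ψ F :=
  congrArg (fun ν : WeakDual ℝ (Biaffine S probMeasures) => ν F) h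

theorem eq_of_functional {φ ψ χ : (S.projTensor probMeasures).Pt} {a b : ℝ}
    (h : ∀ F, functional χ F = a * functional φ F + b * functional ψ F) :
    (χ : (S.projTensor probMeasures).Space) = a • φ.1 + b • ψ.1 :=
  ContinuousLinearMap.ext h

theorem continuous_omega_dirac :
    Continuous fun p : S.Pt × unitInterval => S.omega probMeasures p.1 (dirac p.2) :=
  Continuous.subtype_mk (WeakDual.continuous_of_continuous_eval fun F => by
    change Continuous fun p : S.Pt × unitInterval => F.1 (p.1, dirac p.2)
    have := continuous_dirac
    fun_prop) _

theorem isAffine_omega (μ : probMeasures.Pt) :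
    S.IsAffine fun s => (S.omega probMeasures s μ : (S.projTensor probMeasures).Space) :=
  fun x y z a b ha hb hab h => eq_of_functional fun F => F.2.1 μ x y z a b ha hb hab h

theorem isAffine_apply_hom {T : CompactConvex.{w}} (f : T.affineFunctions) {H : S.Pt → T.Pt}
    (hH : S.IsAffine fun s => (H s : T.Space)) : S.IsAffine fun s => f.1 (H s) :=
  fun x y z a b ha hb hab h => f.2 _ _ _ a b ha hb hab (hH x y z a b ha hb hab h)

/-- The map of function spaces induced by a continuous family of affine maps `S → T`. -/
noncomputable def pullback {T : CompactConvex.{w}} (H : C(S.Pt × unitInterval, T.Pt))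
    (hH : ∀ t, S.IsAffine fun s => (H (s, t) : T.Space)) :
    T.affineFunctions →ₗ[ℝ] Biaffine S probMeasures where
  toFun f := Biaffine.integral (f.1.comp H) fun t => isAffine_apply_hom f (hH t)
  map_add' f g := Subtype.ext <| ContinuousMap.ext fun p =>
    (integ p.2).map_add ((f.1.comp H).curry p.1) ((g.1.comp H).curry p.1)
  map_smul' c f := Subtype.ext <| ContinuousMap.ext fun p =>
    (integ p.2).map_smul c ((f.1.comp H).curry p.1)

/-- A continuous family of affine maps `S → T` extends to the tensor product. -/
theorem exists_extension {T : CompactConvex.{w}} (H : C(S.Pt × unitInterval, T.Pt))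
    (hH : ∀ t, S.IsAffine fun s => (H (s, t) : T.Space)) :
    ∃ h : (S.projTensor probMeasures).Pt → T.Pt, Continuous h ∧
      ((S.projTensor probMeasures).IsAffine fun φ => (h φ : T.Space)) ∧
      (∀ φ f, f.1 (h φ) = functional φ (pullback H hH f)) ∧
      ∀ s t, h (S.omega probMeasures s (dirac t)) = H (s, t) := by
  have hex (φ : (S.projTensor probMeasures).Pt) :
      ∃ y : T.Pt, ∀ f, f.1 y = functional φ (pullback H hH f) :=
    exists_eval ((functional φ).toLinearMap ∘ₗ pullback H hH)
      (fun f hf => functional_nonneg φ fun p => integ_nonneg p.2 fun t => hf _)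
      ((congrArg (functional φ) (Subtype.ext <| ContinuousMap.ext fun p => apply_one p.2)).trans
        (functional_one φ))
  choose h hh using hex
  refine ⟨h, ?_, ?_, hh, ?_⟩
  -- By compactness, `T` carries the topology induced by its continuous affine functions, so
  -- continuity can be tested on these.
  · let ev : T.Pt → (T.affineFunctions → ℝ) := fun y f => f.1 y
    have hev : Topology.IsClosedEmbedding ev := by
      refine Continuous.isClosedEmbedding (continuous_pi fun f => f.1.continuous) ?_
      exact fun x y hxy => eq_of_forall_affineFunctions fun f => congrFun hxy f
    rw [hev.isInducing.continuous_iff]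
    refine continuous_pi fun f => ?_
    simp only [Function.comp_def, ev, hh]
    exact continuous_functional_apply _
  · intro φ ψ χ a b ha hb hab hχ
    refine congrArg Subtype.val (eq_of_forall_affineFunctions
      (y := T.combo (h φ) (h ψ) ha hb hab) fun f => ?_)
    rw [f.2 (h φ) (h ψ) (T.combo (h φ) (h ψ) ha hb hab) a b ha hb hab rfl, hh, hh, hh,
      functional_convex hχ]
    rfl
  · intro s t
    refine eq_of_forall_affineFunctions fun f => ?_
    rw [hh]; rfl

/-! ### Extreme points of `S ⊗ P` -/

/-- With `g(t') = sup_s |F(s, δ_t')|`, the function `∫ g dμ` is biaffine, bounds `|F|`, and vanishes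
at `μ = δ_t`. Domination by the evaluation at `(s, δ_t)` makes `φ` vanish on it, hence on `F`. -/
theorem functional_eq_zero {φ : (S.projTensor probMeasures).Pt} {s : S.Pt} {t : unitInterval}
    {a : ℝ} (ha : 0 < a)
    (h : ∀ F : Biaffine S probMeasures, (∀ x, 0 ≤ F.1 x) → a * functional φ F ≤ F.1 (s, dirac t))
    (F : Biaffine S probMeasures) (hF : ∀ s, F.1 (s, dirac t) = 0) : functional φ F = 0 := by
  let c : C(unitInterval, C(S.Pt, ℝ)) := ContinuousMap.curry
    ⟨fun p => F.1 (p.2, dirac p.1), by have := continuous_dirac; fun_prop⟩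
  let g : C(unitInterval, ℝ) := ⟨fun t => ‖c t‖, by fun_prop⟩
  have hc : c t = 0 := ContinuousMap.ext hF
  have hG0 : functional φ (Biaffine.ofSnd S g) = 0 := by
    have hnn : ∀ x, 0 ≤ (Biaffine.ofSnd S g).1 x := fun x =>
      integ_nonneg x.2 fun t => norm_nonneg (c t)
    have h1 := h (Biaffine.ofSnd S g) hnn
    have h2 := functional_nonneg φ hnn
    have h3 : (Biaffine.ofSnd S g).1 (s, dirac t) = 0 := by
      change ‖c t‖ = 0
      rw [hc, norm_zero]
    rw [h3] at h1
    nlinarith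
  have hle (s : S.Pt) (t : unitInterval) : |F.1 (s, dirac t)| ≤ g t := (c t).norm_coe_le_norm s
  have h1 := functional_nonneg φ (F := Biaffine.ofSnd S g - F) fun x => by
    change 0 ≤ integ x.2 g - F.1 (x.1, x.2)
    rw [Biaffine.apply_eq, ← (integ x.2).map_sub]
    exact integ_nonneg _ fun t => sub_nonneg.mpr (abs_le.mp (hle x.1 t)).2
  have h2 := functional_nonneg φ (F := Biaffine.ofSnd S g + F) fun x => by
    change 0 ≤ integ x.2 g + F.1 (x.1, x.2)
    rw [Biaffine.apply_eq, ← (integ x.2).map_add]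
    exact integ_nonneg _ fun t => neg_le_iff_add_nonneg'.mp (abs_le.mp (hle x.1 t)).1
  rw [map_sub, hG0] at h1
  rw [map_add, hG0] at h2
  linarith

/-- A state dominated by a multiple of an evaluation at `(s, δ_t)` is an evaluation at some
`(y, δ_t)`. -/
theorem exists_eq_omega {φ : (S.projTensor probMeasures).Pt} {s : S.Pt} {t : unitInterval}
    {a : ℝ} (ha : 0 < a)
    (h : ∀ F : Biaffine S probMeasures, (∀ x, 0 ≤ F.1 x) →
      a * functional φ F ≤ F.1 (s, dirac t)) :
    ∃ y, φ = S.omega probMeasures y (dirac t) := by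
  -- The point `y` represents `φ` restricted to functions of the first variable; modulo functions
  -- vanishing on the slice at `δ_t`, there are no others.
  obtain ⟨y, hy⟩ := exists_eval ((functional φ).toLinearMap ∘ₗ Biaffine.ofFst S)
      (fun f hf => functional_nonneg φ fun p => hf p.1) (functional_one φ)
  refine ⟨y, functional_injective (ContinuousLinearMap.ext fun F => ?_)⟩
  rw [functional_omega]
  have h1 := functional_eq_zero ha h (F - Biaffine.ofFst S (Biaffine.slice F (dirac t)))
    fun s => sub_self (F.1 (s, dirac t))
  rw [map_sub, sub_eq_zero] at h1
  rw [h1]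
  exact (hy (Biaffine.slice F (dirac t))).symm

theorem eq_convex_of_omega {x y z : S.Pt} {μ : probMeasures.Pt} {a b : ℝ} (ha : 0 ≤ a)
    (hb : 0 ≤ b) (hab : a + b = 1)
    (h : (S.omega probMeasures z μ : (S.projTensor probMeasures).Space) =
      a • (S.omega probMeasures x μ).1 + b • (S.omega probMeasures y μ).1) :
    (z : S.Space) = a • (x : S.Space) + b • (y : S.Space) :=
  congrArg Subtype.val <| eq_of_forall_affineFunctions (y := S.combo x y ha hb hab) fun f =>
    (functional_convex h (Biaffine.ofFst S f)).trans (f.2 x y _ a b ha hb hab rfl).symm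

theorem omega_injective (μ : probMeasures.Pt) :
    Function.Injective fun s => S.omega probMeasures s μ := fun _ _ h =>
  eq_of_forall_affineFunctions fun f => congrArg (fun φ => functional φ (Biaffine.ofFst S f)) h

/-- If `s ⊗ δ_t = aφ + bψ`, then `aφ` and `bψ` are dominated by it, so `φ = y ⊗ δ_t` and `ψ = z ⊗
δ_t`. Then `s = ay + bz`, and extremality of `s` gives `y = z = s`. -/
theorem isExtremePt_omega_dirac {s : S.Pt} (hs : S.IsExtremePt s) (t : unitInterval) :
    (S.projTensor probMeasures).IsExtremePt (S.omega probMeasures s (dirac t)) := by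
  refine (mem_extremePoints (𝕜 := ℝ)).mpr ⟨(S.omega probMeasures s (dirac t)).2, ?_⟩
  rintro φ hφ ψ hψ ⟨a, b, ha, hb, hab, h⟩
  have key := functional_convex (φ := ⟨φ, hφ⟩) (ψ := ⟨ψ, hψ⟩)
    (χ := S.omega probMeasures s (dirac t)) h.symm
  obtain ⟨y, hy⟩ := exists_eq_omega (φ := ⟨φ, hφ⟩) (s := s) (t := t) ha fun F hF => by
    rw [← functional_omega, key]
    exact le_add_of_nonneg_right (mul_nonneg hb.le (functional_nonneg _ hF))
  obtain ⟨z, hz⟩ := exists_eq_omega (φ := ⟨ψ, hψ⟩) (s := s) (t := t) hb fun F hF => by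
    rw [← functional_omega, key]
    exact le_add_of_nonneg_left (mul_nonneg ha.le (functional_nonneg _ hF))
  have hφy := congrArg Subtype.val hy
  have hψz := congrArg Subtype.val hz
  dsimp only at hφy hψz
  subst hφy hψz
  obtain ⟨h1, h2⟩ := (mem_extremePoints.mp hs).2 y y.2 z z.2
    ⟨a, b, ha, hb, hab, (eq_convex_of_omega ha.le hb.le hab h.symm).symm⟩
  rw [Subtype.ext h1, Subtype.ext h2]
  exact ⟨rfl, rfl⟩

/-- Take the hull itself as target `T` and extend the family `s ↦ s ⊗ δ_t` to `h : S ⊗ P → T`. Since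
a biaffine function is the integral of its values at Dirac measures, `h` fixes every state, so every
state lies in the hull. -/
theorem states_subset_closedConvexHull :
    states S probMeasures ⊆ closedConvexHull ℝ (Set.range fun p : S.Pt × unitInterval =>
      ((S.omega probMeasures p.1 (dirac p.2) : (S.projTensor probMeasures).Space) :
        WeakDual ℝ (Biaffine S probMeasures))) := by
  set K := Set.range fun p : S.Pt × unitInterval =>
      ((S.omega probMeasures p.1 (dirac p.2) : (S.projTensor probMeasures).Space) :
        WeakDual ℝ (Biaffine S probMeasures)) with hK
  have hsub : closedConvexHull ℝ K ⊆ states S probMeasures := by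
    refine closedConvexHull_min ?_ (convex_states _ _) (isCompact_states _ _).isClosed
    rintro _ ⟨p, rfl⟩
    exact (S.omega probMeasures p.1 (dirac p.2)).2
  let T : CompactConvex.{u} :=
    { Space := WeakDual ℝ (Biaffine S probMeasures)
      carrier := closedConvexHull ℝ K
      convex := convex_closedConvexHull
      isCompact := (isCompact_states S probMeasures).of_isClosed_subset
        isClosed_closedConvexHull hsub }
  intro φ hφ
  obtain ⟨h, -, -, hh, -⟩ := exists_extension (S := S) (T := T)
    ⟨fun p => ⟨(S.omega probMeasures p.1 (dirac p.2)).1, subset_closedConvexHull ⟨p, rfl⟩⟩,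
      (continuous_subtype_val.comp continuous_omega_dirac).subtype_mk _⟩
    (fun t => isAffine_omega (dirac t))
  have : (h ⟨φ, hφ⟩).1 = φ := ContinuousLinearMap.ext fun F =>
    (hh ⟨φ, hφ⟩ ⟨⟨fun ψ : T.Pt => (show WeakDual ℝ (Biaffine S probMeasures) from ψ.1) F,
        (WeakDual.eval_continuous F).comp continuous_subtype_val⟩,
      fun _ _ _ _ _ _ _ _ h =>
        congrArg (fun ν : WeakDual ℝ (Biaffine S probMeasures) => ν F) h⟩).trans
      (congrArg (functional ⟨φ, hφ⟩) (Subtype.ext <| ContinuousMap.ext fun p =>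
        (Biaffine.apply_eq F p.1 p.2).symm))
  exact this ▸ (h ⟨φ, hφ⟩).2

theorem exists_of_isExtremePt {φ : (S.projTensor probMeasures).Pt}
    (hφ : (S.projTensor probMeasures).IsExtremePt φ) :
    ∃ s t, S.IsExtremePt s ∧ φ = S.omega probMeasures s (dirac t) := by
  have hc : Continuous fun p : S.Pt × unitInterval =>
      ((S.omega probMeasures p.1 (dirac p.2) : (S.projTensor probMeasures).Space) :
        WeakDual ℝ (Biaffine S probMeasures)) :=
    continuous_subtype_val.comp continuous_omega_dirac
  obtain ⟨⟨s, t⟩, h⟩ := mem_of_mem_extremePoints_of_subset_closedConvexHull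
    (isCompact_states S probMeasures) (convex_states S probMeasures) (isCompact_range hc)
    (by rintro _ ⟨p, rfl⟩; exact (S.omega probMeasures p.1 (dirac p.2)).2)
    states_subset_closedConvexHull hφ
  obtain rfl : S.omega probMeasures s (dirac t) = φ := Subtype.ext h
  -- Extremality descends to `s` because `s ↦ s ⊗ δ_t` is affine and injective.
  refine ⟨s, t, mem_extremePoints.mpr ⟨s.2, ?_⟩, rfl⟩
  rintro x hx y hy ⟨a, b, ha, hb, hab, hs⟩
  have h := (mem_extremePoints.mp hφ).2 _ (S.omega probMeasures ⟨x, hx⟩ (dirac t)).2 _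
    (S.omega probMeasures ⟨y, hy⟩ (dirac t)).2 ⟨a, b, ha, hb, hab,
      (isAffine_omega (dirac t) ⟨x, hx⟩ ⟨y, hy⟩ s a b ha.le hb.le hab hs.symm).symm⟩
  exact ⟨congrArg Subtype.val (omega_injective (dirac t) (Subtype.ext h.1)),
    congrArg Subtype.val (omega_injective (dirac t) (Subtype.ext h.2))⟩

/-! ### The homotopical structure -/

/-- The morphism `s ↦ s ⊗ δ_t`. -/
noncomputable def inclusion (S : CompactConvex.{u}) (t : unitInterval) :
    S ⟶ S.projTensor probMeasures where
  toFun s := S.omega probMeasures s (dirac t)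
  continuous_toFun := continuous_omega_dirac.comp (by fun_prop : Continuous fun s : S.Pt => (s, t))
  isAffine_toFun := isAffine_omega (dirac t)
  isExtremePt_toFun _ hs := isExtremePt_omega_dirac hs t

/-- A homotopy of morphisms `S ⟶ T` extends to a morphism on the tensor product. -/
theorem exists_hom {T : CompactConvex.{u}} (H : C(S.Pt × unitInterval, T.Pt))
    (hH : ∀ t, S.IsAffine fun s => (H (s, t) : T.Space))
    (hext : ∀ s t, S.IsExtremePt s → T.IsExtremePt (H (s, t))) :
    ∃ h : S.projTensor probMeasures ⟶ T,
      ∀ s t, h.toFun (S.omega probMeasures s (dirac t)) = H (s, t) := by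
  obtain ⟨h, hc, ha, -, hω⟩ := exists_extension H hH
  refine ⟨⟨h, hc, ha, fun φ hφ => ?_⟩, hω⟩
  obtain ⟨s, t, hs, rfl⟩ := exists_of_isExtremePt hφ
  rw [hω]
  exact hext s t hs

end CompactConvex

theorem theorem2 :
    ∃ i j : ∀ S : CompactConvex.{u}, S ⟶ S.projTensor probMeasures,
      (∀ (S : CompactConvex.{u}) (s : S.Pt), (i S).toFun s = S.omega probMeasures s (dirac 0)) ∧
      (∀ (S : CompactConvex.{u}) (s : S.Pt), (j S).toFun s = S.omega probMeasures s (dirac 1)) ∧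
      IsHomotopicalStructure (fun S : CompactConvex.{u} => S.projTensor probMeasures) i j := by
  refine ⟨fun S => S.inclusion 0, fun S => S.inclusion 1, fun _ _ => rfl, fun _ _ => rfl,
    fun S => ?_, fun S => ?_, fun S T h h' hh => ?_, fun S T f => ?_⟩
  · obtain ⟨p, hp⟩ := exists_hom (S := S) (T := S) ⟨Prod.fst, continuous_fst⟩
      (fun _ _ _ _ _ _ _ _ _ h => h) (fun _ _ hs => hs)
    exact ⟨p, Hom.ext (funext fun s => hp s 0), Hom.ext (funext fun s => hp s 1)⟩
  · obtain ⟨k, hk⟩ := exists_hom (S := S) (T := S.projTensor probMeasures)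
      ⟨fun p => S.omega probMeasures p.1 (dirac (unitInterval.symm p.2)),
        continuous_omega_dirac.comp (by fun_prop :
          Continuous fun p : S.Pt × unitInterval => (p.1, unitInterval.symm p.2))⟩
      (fun t => isAffine_omega (dirac (unitInterval.symm t)))
      (fun _ _ hs => isExtremePt_omega_dirac hs _)
    refine ⟨k, Hom.ext (funext fun s => (hk s 0).trans ?_),
      Hom.ext (funext fun s => (hk s 1).trans ?_)⟩
    · change S.omega probMeasures s (dirac (unitInterval.symm 0)) = _
      rw [unitInterval.symm_zero]; rfl
    · change S.omega probMeasures s (dirac (unitInterval.symm 1)) = _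
      rw [unitInterval.symm_one]; rfl
  · have hmid (s : S.Pt) : h'.toFun (S.omega probMeasures s (dirac 0)) =
        h.toFun (S.omega probMeasures s (dirac 1)) := congrArg (fun g : S ⟶ T => g.toFun s) hh
    have hcont (g : S.projTensor probMeasures ⟶ T) : Continuous
        fun p : unitInterval × S.Pt => g.toFun (S.omega probMeasures p.2 (dirac p.1)) :=
      g.continuous_toFun.comp (continuous_omega_dirac.comp continuous_swap)
    let G (g : S.projTensor probMeasures ⟶ T) (t : unitInterval) : S ⟶ T := S.inclusion t ≫ g
    let c (g : S ⟶ T) : C(S.Pt, T.Pt) := ⟨g.toFun, g.continuous_toFun⟩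
    let F₁ : ContinuousMap.Homotopy (c (G h 0)) (c (G h 1)) :=
      { toFun := fun p => h.toFun (S.omega probMeasures p.2 (dirac p.1))
        continuous_toFun := hcont h
        map_zero_left := fun _ => rfl
        map_one_left := fun _ => rfl }
    -- Starting `F₂` at the end of `F₁` is where the compatibility of `h` and `h'` enters.
    let F₂ : ContinuousMap.Homotopy (c (G h 1)) (c (G h' 1)) :=
      { toFun := fun p => h'.toFun (S.omega probMeasures p.2 (dirac p.1))
        continuous_toFun := hcont h'
        map_zero_left := hmid
        map_one_left := fun _ => rfl }
    -- Each time slice of the concatenation is a slice of `h` (at `2t`) or of `h'` (at `2t - 1`),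
    -- hence a morphism.
    have key (t : unitInterval) : ∃ g : S ⟶ T, ∀ s, (F₁.trans F₂) (t, s) = g.toFun s := by
      by_cases ht : (t : ℝ) ≤ 1 / 2
      · exact ⟨G h ⟨2 * t, (unitInterval.mul_pos_mem_iff zero_lt_two).2 ⟨t.2.1, ht⟩⟩, fun s => by
          rw [ContinuousMap.Homotopy.trans_apply, dif_pos ht]; rfl⟩
      · exact ⟨G h' ⟨2 * t - 1, unitInterval.two_mul_sub_one_mem_iff.2
          ⟨(not_le.1 ht).le, t.2.2⟩⟩, fun s => by
          rw [ContinuousMap.Homotopy.trans_apply, dif_neg ht]; rfl⟩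
    obtain ⟨h'', hω⟩ := exists_hom (S := S) (T := T)
      ((F₁.trans F₂).toContinuousMap.comp ⟨Prod.swap, continuous_swap⟩)
      (fun t => by
        obtain ⟨g, hg⟩ := key t
        have : (fun s => (((F₁.trans F₂).toContinuousMap.comp ⟨Prod.swap, continuous_swap⟩)
            (s, t) : T.Space)) = fun s => (g.toFun s : T.Space) :=
          funext fun s => congrArg Subtype.val (hg s)
        rw [this]
        exact g.isAffine_toFun)
      (fun s t hs => by
        obtain ⟨g, hg⟩ := key t
        exact (hg s).symm ▸ g.isExtremePt_toFun s hs)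
    exact ⟨h'', Hom.ext (funext fun s => ((hω s 0).trans ((F₁.trans F₂).map_zero_left s)).symm),
      Hom.ext (funext fun s => ((hω s 1).trans ((F₁.trans F₂).map_one_left s)).symm)⟩
  · obtain ⟨g, hg⟩ := exists_hom (S := S) (T := T.projTensor probMeasures)
      ⟨fun p => T.omega probMeasures (f.toFun p.1) (dirac p.2),
        continuous_omega_dirac.comp (f.continuous_toFun.prodMap continuous_id)⟩
      (fun t => (f ≫ T.inclusion t).isAffine_toFun)
      (fun s t hs => (f ≫ T.inclusion t).isExtremePt_toFun s hs)
    exact ⟨g, Hom.ext (funext fun s => hg s 0), Hom.ext (funext fun s => hg s 1)⟩
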